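/- All Banach spaces are real. Let $X$ be a Banach space with dual $X^*$. The Mackey topology $\mu(X^*,X)$ is the topology on $X^*$ of uniform convergence on the weakly compact subsets of $X$. A convex block subsequence of a sequence $(f_n)_{n\in\mathbb{N}}$ in a linear space is a sequence of the form $g_k=\sum_{n\in I_k}a_n f_n$ ($k\in\mathbb{N}$), where $(I_k)$ is a sequence of finite non-empty subsets of $\mathbb{N}$ with $\max(I_k)<\min(I_{k+1})$ and $(a_n)$ is a sequence of non-negative real numbers with $\sum_{n\in I_k}a_n=1$ for all $k\in\mathbb{N}$. The space $X$ has property (K) if every $w^*$-convergent sequence in $X^*$ admits a convex block subsequence which is $\mu(X^*,X)$-convergent. Let $\mathfrak{p}$ be the least cardinality of a family $\mathcal{M}$ of infinite subsets of $\mathbb{N}$ such that $\bigcap\mathcal{N}$ is infinite for every finite subfamily $\mathcal{N}\subseteq\mathcal{M}$, but there is no infinite set $A\subseteq\mathbb{N}$ such that $A\setminus M$ is finite for all $M\in\mathcal{M}$. **Theorem.** Let $\{X_i\}_{i\in I}$ be a collection of Banach spaces having property (K). If $|I|<\mathfrak{p}$, then the $\ell^1$-sum $\left(\bigoplus_{i\in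 I}X_i\right)_{\ell^1}$ has property (K). -/

import Mathlib

open Filter Topology Cardinal
open scoped ENNReal

universe u v

/-- `y` is a convex block subsequence of `x`: `y k = ∑ n ∈ I k, a n • x n`, where `(I k)` are finite
sets of indices with `max (I k) < min (I (k + 1))` and the `a n` are non-negative reals with
`∑ n ∈ I k, a n = 1` for all `k` (in particular every `I k` is non-empty). -/
def IsConvexBlockSubseq {E : Type*} [AddCommGroup E] [Module ℝ E] (y x : ℕ → E) : Prop :=
  ∃ (I : ℕ → Finset ℕ) (a : ℕ → ℝ),
    (∀ k, ∀ m ∈ I k, ∀ n ∈ I (k + 1), m < n) ∧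
    (∀ n, 0 ≤ a n) ∧
    (∀ k, ∑ n ∈ I k, a n = 1) ∧
    ∀ k, y k = ∑ n ∈ I k, a n • x n

/-- The family of all weakly compact subsets of `X`. -/
def weaklyCompactSets (X : Type*) [NormedAddCommGroup X] [NormedSpace ℝ X] : Set (Set X) :=
  {L | IsCompact (toWeakSpace ℝ X '' L)}

/-- The dual of `X` with the Mackey topology `μ(X*, X)`, i.e. the topology of uniform convergence
on the weakly compact subsets of `X`. -/
abbrev MackeyDual (X : Type*) [NormedAddCommGroup X] [NormedSpace ℝ X] : Type _ :=
  UniformConvergenceCLM (RingHom.id ℝ) (E := X) ℝ (weaklyCompactSets X)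

/-- A functional, viewed as an element of the dual with its Mackey topology. -/
noncomputable def toMackeyDual {X : Type*} [NormedAddCommGroup X] [NormedSpace ℝ X] (f : StrongDual ℝ X) :
    MackeyDual X :=
  UniformConvergenceCLM.ofFun (RingHom.id ℝ) ℝ (weaklyCompactSets X) f

theorem tendsto_toMackeyDual_iff {X : Type*} [NormedAddCommGroup X] [NormedSpace ℝ X]
    (y : ℕ → StrongDual ℝ X) (f : StrongDual ℝ X) :
    Tendsto (fun n => toMackeyDual (y n)) atTop (𝓝 (toMackeyDual f)) ↔
      ∀ L : Set X, IsCompact (toWeakSpace ℝ X '' L) →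
        TendstoUniformlyOn (fun n v => y n v) (fun v => f v) atTop L :=
  UniformConvergenceCLM.tendsto_iff_tendstoUniformlyOn (RingHom.id ℝ) ℝ (weaklyCompactSets X)

/-- Property (K): every weak-star convergent sequence in the dual of `X` admits a convex block
subsequence which converges in the Mackey topology. -/
def PropertyK (X : Type*) [NormedAddCommGroup X] [NormedSpace ℝ X] : Prop :=
  ∀ (x : ℕ → StrongDual ℝ X) (x₀ : StrongDual ℝ X),
    Tendsto (fun n => StrongDual.toWeakDual (x n)) atTop (𝓝 (StrongDual.toWeakDual x₀)) →
    ∃ y : ℕ → StrongDual ℝ X, IsConvexBlockSubseq y x ∧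
      ∃ y₀ : StrongDual ℝ X,
        Tendsto (fun n => toMackeyDual (y n)) atTop (𝓝 (toMackeyDual y₀))

/-- Families of infinite subsets of `ℕ` all of whose finite subfamilies have infinite intersection,
but for which there is no infinite set almost contained in each member. -/
def IsUnboundedCenteredFamily (M : Set (Set ℕ)) : Prop :=
  (∀ A ∈ M, A.Infinite) ∧
  (∀ N : Finset (Set ℕ), (N : Set (Set ℕ)) ⊆ M → (⋂ A ∈ N, A).Infinite) ∧
  ¬ ∃ A : Set ℕ, A.Infinite ∧ ∀ B ∈ M, (A \ B).Finite

/-- Such families exist (a non-principal ultrafilter is one), so the infimum below is a minimum. -/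
theorem exists_isUnboundedCenteredFamily : ∃ M : Set (Set ℕ), IsUnboundedCenteredFamily M := by
  have hinf : ∀ A ∈ (hyperfilter ℕ), A.Infinite := fun A hA hfin =>
    notMem_hyperfilter_of_finite hfin hA
  refine ⟨{A | A ∈ hyperfilter ℕ}, hinf, fun N hN => hinf _ ?_, ?_⟩
  · exact (Filter.biInter_finset_mem N).2 fun A hA => hN hA
  · rintro ⟨A, hA, h⟩
    obtain ⟨f, hf, hfA⟩ : ∃ f : ℕ → ℕ, StrictMono f ∧ ∀ n, f n ∈ A :=
      ⟨Nat.nth (· ∈ A), Nat.nth_strictMono hA, Nat.nth_mem_of_infinite hA⟩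
    have hinj := hf.injective
    have key : ∀ g : ℕ → ℕ, Function.Injective g → (∀ n, g n ∈ A) →
        (Set.range g)ᶜ ∉ hyperfilter ℕ := fun g hg hgA hmem =>
      (Set.infinite_range_of_injective hg) ((h _ hmem).subset (by
        rintro _ ⟨n, rfl⟩
        exact ⟨hgA n, fun hn => hn ⟨n, rfl⟩⟩))
    have h0 := key (fun n => f (2 * n)) (fun a b hab => by have := hinj hab; omega)
      (fun n => hfA _)
    have h1 := key (fun n => f (2 * n + 1)) (fun a b hab => by have := hinj hab; omega)
      (fun n => hfA _)
    rw [Ultrafilter.compl_mem_iff_notMem, not_not] at h0 h1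
    obtain ⟨_, ⟨a, rfl⟩, ⟨b, hb⟩⟩ := (hyperfilter ℕ).nonempty_of_mem (inter_mem h0 h1)
    have := hinj hb
    omega

/-- The pseudo-intersection number `𝔭`. -/
noncomputable def pseudoIntersectionNumber : Cardinal.{0} :=
  sInf {c | ∃ M : Set (Set ℕ), IsUnboundedCenteredFamily M ∧ #M = c}

/-! Let `x` be weak-star convergent to `x₀` in the dual of the `ℓ¹`-sum. Property (K) of `X i` makes
a convex block subsequence of `x` Mackey convergent on the summand `X i`, and a transfinite
diagonalisation of length `#I < 𝔭` handles all summands at once: at every step, the members of a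
separable convex set that lie `1 / (n + 1)`-close to the convex hull of the `n`-th tail of each
earlier sequence form fewer than `𝔭` open sets with the finite intersection property, and a
pseudo-intersection of their traces on a dense sequence is a lower bound.

Coordinatewise Mackey convergence of a weak-star convergent sequence is Mackey convergence, since
the norms of the tails are uniformly small on a weakly compact subset of the `ℓ¹`-sum. Otherwise
infinitely many disjoint finite blocks of coordinates each carry mass at least `ε` of some vector of
the set; sending a vector to the values of norming functionals on these blocks maps the set to a
weakly compact subset of `ℓ¹(ℕ)`, which is norm compact by Schur's theorem, a contradiction.
-/

section PseudoIntersection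

theorem exists_pseudoIntersection_of_countable (A : ℕ → Set ℕ)
    (hA : ∀ F : Finset ℕ, (⋂ n ∈ F, A n).Infinite) :
    ∃ B : Set ℕ, B.Infinite ∧ ∀ n, (B \ A n).Finite := by
  obtain ⟨φ, hφ, hmem⟩ := extraction_forall_of_frequently
    (P := fun n k => k ∈ ⋂ m ∈ Finset.range (n + 1), A m)
    (fun n => Nat.frequently_atTop_iff_infinite.2 (hA (Finset.range (n + 1))))
  refine ⟨Set.range φ, Set.infinite_range_of_injective hφ.injective, fun n => ?_⟩
  refine ((Set.finite_lt_nat n).image φ).subset ?_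
  rintro _ ⟨⟨m, rfl⟩, hm⟩
  refine ⟨m, ?_, rfl⟩
  by_contra hmn
  exact hm (Set.mem_iInter₂.1 (hmem m) n (Finset.mem_range.2 (Nat.lt_succ_of_le (not_lt.1 hmn))))

theorem IsUnboundedCenteredFamily.aleph0_lt_mk {M : Set (Set ℕ)}
    (hM : IsUnboundedCenteredFamily M) : ℵ₀ < #M := by
  classical
  obtain ⟨-, hinter, hunbounded⟩ := hM
  by_contra hle
  have hcount : M.Countable := Cardinal.le_aleph0_iff_set_countable.1 (not_lt.1 hle)
  rcases M.eq_empty_or_nonempty with rfl | hne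
  · exact hunbounded ⟨Set.univ, Set.infinite_univ, by simp⟩
  obtain ⟨A, rfl⟩ := hcount.exists_eq_range hne
  obtain ⟨B, hB, hBA⟩ := exists_pseudoIntersection_of_countable A fun F => by
    simpa using hinter (F.image A) (by simp)
  exact hunbounded ⟨B, hB, Set.forall_mem_range.2 hBA⟩

theorem aleph0_lt_pseudoIntersectionNumber : ℵ₀ < pseudoIntersectionNumber := by
  obtain ⟨M, hM⟩ := exists_isUnboundedCenteredFamily
  obtain ⟨N, hN, hcard⟩ : pseudoIntersectionNumber ∈
      {c | ∃ M : Set (Set ℕ), IsUnboundedCenteredFamily M ∧ #M = c} := csInf_mem ⟨_, M, hM, rfl⟩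
  exact hcard ▸ hN.aleph0_lt_mk

theorem exists_pseudoIntersection {ι : Type u} (A : ι → Set ℕ)
    (hι : #ι < Cardinal.lift.{u} pseudoIntersectionNumber)
    (hA : ∀ F : Finset ι, (⋂ i ∈ F, A i).Infinite) :
    ∃ B : Set ℕ, B.Infinite ∧ ∀ i, (B \ A i).Finite := by
  classical
  by_contra hunbounded
  have hcentered : IsUnboundedCenteredFamily (Set.range A) := by
    refine ⟨Set.forall_mem_range.2 fun i => by simpa using hA {i}, fun N hN => ?_, ?_⟩
    · obtain ⟨F, -, rfl⟩ := (Finset.subset_set_image_iff (s := Set.univ) (f := A)).1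
        (by rwa [Set.image_univ])
      simpa using hA F
    · rintro ⟨B, hB, hBA⟩
      exact hunbounded ⟨B, hB, fun i => hBA _ ⟨i, rfl⟩⟩
  refine hι.not_ge ?_
  calc Cardinal.lift.{u} pseudoIntersectionNumber ≤ Cardinal.lift.{u} #(Set.range A) :=
        Cardinal.lift_le.2 (csInf_le' ⟨_, hcentered, rfl⟩)
    _ ≤ #ι := by simpa using Cardinal.mk_range_le_lift (f := A)

theorem exists_seq_eventually_mem_of_isOpen {α : Type*} [TopologicalSpace α]
    [TopologicalSpace.SeparableSpace α] {ι : Type u}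
    (hι : #ι < Cardinal.lift.{u} pseudoIntersectionNumber) {U : ι → Set α}
    (hU : ∀ i, IsOpen (U i)) (hfin : ∀ F : Finset ι, (⋂ i ∈ F, U i).Nonempty) :
    ∃ y : ℕ → α, ∀ i, ∀ᶠ k in atTop, y k ∈ U i := by
  have : Nonempty α := (hfin ∅).to_type
  -- Enumerating a dense sequence with infinite repetition makes nonempty open sets infinite.
  let q : ℕ → α := fun n => TopologicalSpace.denseSeq α n.unpair.2
  have hinf (F : Finset ι) : (⋂ i ∈ F, q ⁻¹' U i).Infinite := by
    obtain ⟨_, hmem, m, rfl⟩ := (TopologicalSpace.denseRange_denseSeq α).inter_open_nonempty _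
      (isOpen_biInter_finset fun i _ => hU i) (hfin F)
    refine Set.infinite_of_injective_forall_mem (f := fun n => Nat.pair n m)
      (fun n n' h => (Nat.pair_eq_pair.1 h).1) fun n => ?_
    simpa [q] using hmem
  obtain ⟨B, hB, hBU⟩ := exists_pseudoIntersection (fun i => q ⁻¹' U i) hι hinf
  refine ⟨q ∘ Nat.nth (· ∈ B), fun i => ?_⟩
  have hfinite : {k | Nat.nth (· ∈ B) k ∈ B \ q ⁻¹' U i}.Finite :=
    (hBU i).preimage (Nat.nth_injective hB).injOn
  rw [← Nat.cofinite_eq_atTop]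
  filter_upwards [hfinite.eventually_cofinite_notMem] with k hk
  by_contra hkU
  exact hk ⟨Nat.nth_mem_of_infinite hB k, hkU⟩

end PseudoIntersection

theorem exists_forall_and_forall_lt {ι α : Type*} [Preorder ι] [WellFoundedLT ι] [Nonempty α]
    {P : ι → α → Prop} {r : α → α → Prop}
    (h : ∀ (i : ι) (f : Set.Iio i → α), (∀ j : Set.Iio i, P j (f j)) →
        (∀ j k : Set.Iio i, j < k → r (f j) (f k)) → ∃ a, P i a ∧ ∀ j, r (f j) a) :
    ∃ f : ι → α, (∀ i, P i (f i)) ∧ ∀ i j, i < j → r (f i) (f j) := by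
  choose! φ hP hr using h
  let f : ι → α := wellFounded_lt.fix fun i g => φ i fun j => g j.1 j.2
  have hf (i : ι) : f i = φ i fun j => f j := WellFounded.fix_eq _ _ _
  have hPr (i : ι) : P i (f i) ∧ ∀ j < i, r (f j) (f i) := by
    induction i using WellFoundedLT.induction with
    | ind i ih =>
      rw [hf i]
      exact ⟨hP i _ (fun j => (ih j.1 j.2).1) fun j k hjk => (ih k.1 k.2).2 j hjk,
        fun j hj => hr i (fun j => f j) (fun j => (ih j.1 j.2).1)
          (fun j k hjk => (ih k.1 k.2).2 j hjk) ⟨j, hj⟩⟩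
  exact ⟨f, fun i => (hPr i).1, fun i j hij => (hPr j).2 i hij⟩

section ConvexBlock

variable {V W : Type*} [AddCommGroup V] [Module ℝ V] [AddCommGroup W] [Module ℝ W]

theorem exists_finset_sum_eq_of_mem_convexHull_image {ι : Type*} {x : ι → V} {s : Set ι} {p : V}
    (hp : p ∈ convexHull ℝ (x '' s)) :
    ∃ (F : Finset ι) (a : ι → ℝ), (∀ n ∈ F, n ∈ s) ∧ (∀ n, 0 ≤ a n) ∧ ∑ n ∈ F, a n = 1 ∧
      ∑ n ∈ F, a n • x n = p := by
  classical
  obtain ⟨_, n₀, -, -⟩ : (x '' s).Nonempty := convexHull_nonempty_iff.1 ⟨p, hp⟩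
  have : Nonempty ι := ⟨n₀⟩
  rw [convexHull_eq] at hp
  obtain ⟨κ, t, w, z, hw, hw1, hz, rfl⟩ := hp
  choose! n hns hnz using hz
  have hmaps : ∀ i ∈ t, n i ∈ t.image n := fun i => Finset.mem_image_of_mem n
  refine ⟨t.image n, fun m => ∑ i ∈ t with n i = m, w i, Finset.forall_mem_image.2 hns,
    fun m => Finset.sum_nonneg fun i hi => hw i (Finset.mem_filter.1 hi).1,
    (Finset.sum_fiberwise_of_maps_to hmaps _).trans hw1, ?_⟩
  rw [Finset.centerMass_eq_of_sum_1 _ _ hw1, ← Finset.sum_fiberwise_of_maps_to hmaps]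
  refine Finset.sum_congr rfl fun m _ => ?_
  rw [Finset.sum_smul]
  refine Finset.sum_congr rfl fun i hi => ?_
  obtain ⟨hit, rfl⟩ := Finset.mem_filter.1 hi
  rw [hnz i hit]

theorem IsConvexBlockSubseq.mem_convexHull {y x : ℕ → V} (h : IsConvexBlockSubseq y x) (k : ℕ) :
    y k ∈ convexHull ℝ (x '' Set.Ici k) := by
  obtain ⟨I, a, hlt, ha, hsum, hy⟩ := h
  have hge (k : ℕ) : ∀ n ∈ I k, k ≤ n := by
    induction k with
    | zero => exact fun n _ => n.zero_le
    | succ k ih =>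
      intro n hn
      obtain ⟨m, hm⟩ : (I k).Nonempty := Finset.nonempty_of_sum_ne_zero
        (ne_of_eq_of_ne (hsum k) one_ne_zero)
      exact (ih m hm).trans_lt (hlt k m hm n hn)
  rw [hy k]
  exact (convex_convexHull ℝ _).sum_mem (fun n _ => ha n) (hsum k) fun n hn =>
    subset_convexHull ℝ _ ⟨n, hge k n hn, rfl⟩

theorem IsConvexBlockSubseq.exists_eq_comp (T : V →ₗ[ℝ] W) {z : ℕ → V} {y : ℕ → W}
    (h : IsConvexBlockSubseq y (T ∘ z)) : ∃ w, IsConvexBlockSubseq w z ∧ y = T ∘ w := by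
  obtain ⟨I, a, hlt, ha, hsum, hy⟩ := h
  refine ⟨fun k => ∑ n ∈ I k, a n • z n, ⟨I, a, hlt, ha, hsum, fun k => rfl⟩, funext fun k => ?_⟩
  simp only [hy, Function.comp_apply, map_sum, map_smul]

theorem exists_isConvexBlockSubseq_forall {x : ℕ → V} {P : ℕ → V → Prop}
    (h : ∀ k N, ∃ p ∈ convexHull ℝ (x '' Set.Ici N), P k p) :
    ∃ y, IsConvexBlockSubseq y x ∧ ∀ k, P k (y k) := by
  obtain ⟨B, hB, hlt⟩ := exists_forall_and_forall_lt (ι := ℕ) (α := Finset ℕ × (ℕ → ℝ))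
    (P := fun k B => (∀ n, 0 ≤ B.2 n) ∧ ∑ n ∈ B.1, B.2 n = 1 ∧ P k (∑ n ∈ B.1, B.2 n • x n))
    (r := fun B C => ∀ m ∈ B.1, ∀ n ∈ C.1, m < n) fun k B _ _ => by
      obtain ⟨N, hN⟩ := (Finset.univ.biUnion fun j => (B j).1).exists_nat_subset_range
      obtain ⟨_, hp, hPp⟩ := h k N
      obtain ⟨F, a, hF, ha, hsum, rfl⟩ := exists_finset_sum_eq_of_mem_convexHull_image hp
      refine ⟨(F, a), ⟨ha, hsum, hPp⟩, fun j m hm n hn => ?_⟩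
      exact (Finset.mem_range.1 (hN (Finset.mem_biUnion.2 ⟨j, Finset.mem_univ j, hm⟩))).trans_le
        (hF n hn)
  have hunique {k l n : ℕ} (hk : n ∈ (B k).1) (hl : n ∈ (B l).1) : k = l := by
    by_contra hne
    rcases lt_or_gt_of_ne hne with hkl | hkl
    · exact (hlt k l hkl n hk n hl).false
    · exact (hlt l k hkl n hl n hk).false
  -- The blocks are disjoint, so the coefficients glue; off the blocks `b` is arbitrary.
  let b (n : ℕ) : ℝ := (B (Classical.epsilon fun k => n ∈ (B k).1)).2 n
  have hb (k : ℕ) : ∀ n ∈ (B k).1, b n = (B k).2 n := fun n hn => by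
    simp only [b, hunique (Classical.epsilon_spec (p := fun k => n ∈ (B k).1) ⟨k, hn⟩) hn]
  refine ⟨fun k => ∑ n ∈ (B k).1, (B k).2 n • x n, ⟨fun k => (B k).1, b,
    fun k => hlt k (k + 1) k.lt_succ_self, fun n => (hB _).1 n, fun k => ?_, fun k => ?_⟩,
    fun k => (hB k).2.2⟩
  · rw [Finset.sum_congr rfl (hb k), (hB k).2.1]
  · exact Finset.sum_congr rfl fun n hn => by rw [hb k n hn]

end ConvexBlock

/-- The sequence `y` comes arbitrarily close to the convex hull of every tail of `z`. This is a
preorder containing the convex block subsequences, and its lower bounds can be found by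
approximation, unlike those of the relation `IsConvexBlockSubseq`. -/
def IsAlmostConvexSubseq {V : Type*} [SeminormedAddCommGroup V] [NormedSpace ℝ V]
    (y z : ℕ → V) : Prop :=
  ∀ ε > 0, ∀ J : ℕ, ∀ᶠ k in atTop, y k ∈ Metric.thickening ε (convexHull ℝ (z '' Set.Ici J))

namespace IsAlmostConvexSubseq

variable {V : Type*} [SeminormedAddCommGroup V] [NormedSpace ℝ V]

theorem refl (z : ℕ → V) : IsAlmostConvexSubseq z z := by
  intro ε hε J
  filter_upwards [eventually_ge_atTop J] with k hk
  exact Metric.self_subset_thickening hε _ (subset_convexHull ℝ _ ⟨k, hk, rfl⟩)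

theorem trans {y z w : ℕ → V} (hyz : IsAlmostConvexSubseq y z) (hzw : IsAlmostConvexSubseq z w) :
    IsAlmostConvexSubseq y w := by
  intro ε hε J
  obtain ⟨K, hK⟩ := eventually_atTop.1 (hzw (ε / 2) (half_pos hε) J)
  have hsub : convexHull ℝ (z '' Set.Ici K) ⊆
      Metric.thickening (ε / 2) (convexHull ℝ (w '' Set.Ici J)) :=
    convexHull_min (Set.image_subset_iff.2 hK) ((convex_convexHull ℝ _).thickening _)
  filter_upwards [hyz (ε / 2) (half_pos hε) K] with k hk
  simpa only [add_halves] using Metric.thickening_thickening_subset (ε / 2) (ε / 2) _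
    (Metric.thickening_subset_of_subset (ε / 2) hsub hk)

theorem of_isConvexBlockSubseq {y x : ℕ → V} (h : IsConvexBlockSubseq y x) :
    IsAlmostConvexSubseq y x := by
  intro ε hε J
  filter_upwards [eventually_ge_atTop J] with k hk
  exact Metric.self_subset_thickening hε _
    (convexHull_mono (Set.image_mono (Set.Ici_subset_Ici.2 hk)) (h.mem_convexHull k))

theorem of_tendsto_dist {y z : ℕ → V} {m : ℕ → ℕ} (hm : ∀ k, k ≤ m k)
    (h : Tendsto (fun k => dist (y k) (z (m k))) atTop (𝓝 0)) : IsAlmostConvexSubseq y z := by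
  intro ε hε J
  filter_upwards [eventually_ge_atTop J, h.eventually_lt_const hε] with k hk hdist
  exact Metric.mem_thickening_iff.2
    ⟨_, subset_convexHull ℝ _ ⟨m k, hk.trans (hm k), rfl⟩, hdist⟩

theorem of_eventually_mem_thickening {y z : ℕ → V}
    (h : ∀ J : ℕ, ∀ᶠ k in atTop,
      y k ∈ Metric.thickening (1 / ((J : ℝ) + 1)) (convexHull ℝ (z '' Set.Ici J))) :
    IsAlmostConvexSubseq y z := by
  intro ε hε J
  obtain ⟨K, hK⟩ := exists_nat_one_div_lt hε
  filter_upwards [h (max J K)] with k hk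
  have hle : 1 / (((max J K : ℕ) : ℝ) + 1) ≤ ε :=
    (Nat.one_div_le_one_div (le_max_right J K)).trans hK.le
  exact Metric.thickening_mono hle _ (Metric.thickening_subset_of_subset _
    (convexHull_mono (Set.image_mono (Set.Ici_subset_Ici.2 (le_max_left J K)))) hk)

theorem exists_isConvexBlockSubseq {y x : ℕ → V} (h : IsAlmostConvexSubseq y x) :
    ∃ w, IsConvexBlockSubseq w x ∧ IsAlmostConvexSubseq w y := by
  obtain ⟨w, hwx, hw⟩ := exists_isConvexBlockSubseq_forall (x := x)
    (P := fun k p => ∃ m, k ≤ m ∧ dist p (y m) < 1 / ((k : ℝ) + 1)) fun k N => by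
      obtain ⟨m, hm, hkm⟩ := ((h (1 / ((k : ℝ) + 1)) (by positivity) N).and
        (eventually_ge_atTop k)).exists
      obtain ⟨p, hp, hdist⟩ := Metric.mem_thickening_iff.1 hm
      exact ⟨p, hp, m, hkm, by rwa [dist_comm]⟩
  choose m hm hdist using hw
  exact ⟨w, hwx, of_tendsto_dist hm (squeeze_zero (fun _ => dist_nonneg) (fun k => (hdist k).le)
    tendsto_one_div_add_atTop_nhds_zero_nat)⟩

theorem tendsto {E : Type*} [AddCommGroup E] [Module ℝ E] [TopologicalSpace E]
    [IsTopologicalAddGroup E] [LocallyConvexSpace ℝ E] (T : V →L[ℝ] E) {y z : ℕ → V} {f : E}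
    (h : IsAlmostConvexSubseq y z) (hz : Tendsto (T ∘ z) atTop (𝓝 f)) :
    Tendsto (T ∘ y) atTop (𝓝 f) := by
  rw [← tendsto_sub_nhds_zero_iff] at hz ⊢
  intro U hU
  obtain ⟨O, hO, hOU⟩ := exists_nhds_zero_half hU
  obtain ⟨C, ⟨hC, hCconvex⟩, hCO⟩ := (LocallyConvexSpace.convex_basis_zero ℝ E).mem_iff.1 hO
  obtain ⟨ε, hε, hεC⟩ := Metric.mem_nhds_iff.1 (T.continuous.continuousAt.preimage_mem_nhds
    (show C ∈ 𝓝 (T 0) by rwa [map_zero]))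
  obtain ⟨J, hJ⟩ := eventually_atTop.1 (hz.eventually_mem hC)
  have hconvex : Convex ℝ {p | T p - f ∈ C} := by
    simp only [sub_eq_add_neg]
    exact (hCconvex.translate_preimage_left (-f)).linear_preimage T.toLinearMap
  have hhull : convexHull ℝ (z '' Set.Ici J) ⊆ {p | T p - f ∈ C} :=
    convexHull_min (Set.image_subset_iff.2 hJ) hconvex
  rw [mem_map]
  filter_upwards [h ε hε J] with k hk
  obtain ⟨p, hp, hdist⟩ := Metric.mem_thickening_iff.1 hk
  have hdiff : T (y k - p) ∈ C := hεC (by rwa [mem_ball_zero_iff, ← dist_eq_norm])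
  simpa using hOU _ (hCO hdiff) _ (hCO (hhull hp))

end IsAlmostConvexSubseq

section Diagonal

variable {V : Type*} [SeminormedAddCommGroup V] [NormedSpace ℝ V]

theorem isSeparable_convexHull_range (z : ℕ → V) :
    TopologicalSpace.IsSeparable (convexHull ℝ (Set.range z)) :=
  (Set.countable_range z).isSeparable.span (R := ℝ) |>.mono
    (convexHull_min Submodule.subset_span (Submodule.convex _))

theorem exists_forall_isAlmostConvexSubseq {S : Type u} [Nonempty S]
    (hS : #S < Cardinal.lift.{u} pseudoIntersectionNumber) {z : S → ℕ → V}
    (hz : ∀ F : Finset S, ∃ w, ∀ s ∈ F, IsAlmostConvexSubseq w (z s)) :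
    ∃ w, ∀ s, IsAlmostConvexSubseq w (z s) := by
  classical
  let s₀ : S := Classical.arbitrary S
  let U (a : S × ℕ) : Set V :=
    Metric.thickening (1 / ((a.2 : ℝ) + 1)) (convexHull ℝ (z a.1 '' Set.Ici a.2))
  have := (isSeparable_convexHull_range (z s₀)).separableSpace
  have hcard : #(S × ℕ) < Cardinal.lift.{u} pseudoIntersectionNumber := by
    have hp : ℵ₀ < Cardinal.lift.{u} pseudoIntersectionNumber := by
      simpa using aleph0_lt_pseudoIntersectionNumber
    simpa using Cardinal.mul_lt_of_lt hp.le hS hp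
  obtain ⟨w, hw⟩ := exists_seq_eventually_mem_of_isOpen hcard
    (U := fun a => ((↑) : convexHull ℝ (Set.range (z s₀)) → V) ⁻¹' U a)
    (fun a => Metric.isOpen_thickening.preimage continuous_subtype_val) fun F => by
      obtain ⟨y, hy⟩ := hz (insert s₀ (F.image Prod.fst))
      obtain ⟨y', hblock, hy'⟩ := (hy s₀ (Finset.mem_insert_self _ _)).exists_isConvexBlockSubseq
      obtain ⟨k, hk⟩ := ((Finset.eventually_all F).2 fun a ha =>
        (hy'.trans (hy a.1 (Finset.mem_insert_of_mem (Finset.mem_image_of_mem _ ha))))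
          (1 / ((a.2 : ℝ) + 1)) (by positivity) a.2).exists
      exact ⟨⟨y' k, convexHull_mono (Set.image_subset_range _ _) (hblock.mem_convexHull k)⟩,
        Set.mem_iInter₂.2 hk⟩
  exact ⟨fun k => w k, fun s => .of_eventually_mem_thickening fun J => hw (s, J)⟩

theorem exists_isAlmostConvexSubseq_of_chain {S : Type u} [LinearOrder S]
    (hS : #S < Cardinal.lift.{u} pseudoIntersectionNumber) {x : ℕ → V} {z : S → ℕ → V}
    (hzx : ∀ s, IsAlmostConvexSubseq (z s) x)
    (hz : ∀ s t, s < t → IsAlmostConvexSubseq (z t) (z s)) :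
    ∃ w, IsAlmostConvexSubseq w x ∧ ∀ s, IsAlmostConvexSubseq w (z s) := by
  rcases isEmpty_or_nonempty S with hempty | hne
  · exact ⟨x, .refl x, fun s => hempty.elim s⟩
  obtain ⟨w, hw⟩ := exists_forall_isAlmostConvexSubseq hS (z := z) fun F => by
    rcases F.eq_empty_or_nonempty with rfl | hF
    · exact ⟨x, by simp⟩
    · refine ⟨z (F.max' hF), fun s hs => ?_⟩
      rcases (F.le_max' s hs).eq_or_lt with heq | hlt
      · exact heq ▸ .refl _
      · exact hz s _ hlt
  exact ⟨w, (hw hne.some).trans (hzx hne.some), hw⟩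

theorem exists_isAlmostConvexSubseq_forall {I : Type u}
    (hI : #I < Cardinal.lift.{u} pseudoIntersectionNumber) {x : ℕ → V} {D : I → (ℕ → V) → Prop}
    (hmono : ∀ i y z, IsAlmostConvexSubseq y z → D i z → D i y)
    (hdense : ∀ i z, IsAlmostConvexSubseq z x → ∃ y, IsAlmostConvexSubseq y z ∧ D i y) :
    ∃ y, IsAlmostConvexSubseq y x ∧ ∀ i, D i y := by
  obtain ⟨_, _⟩ := exists_wellFoundedLT I
  obtain ⟨z, hz, hanti⟩ := exists_forall_and_forall_lt
    (P := fun i y => IsAlmostConvexSubseq y x ∧ D i y) (r := fun z y => IsAlmostConvexSubseq y z)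
    fun i z hz hanti => by
      obtain ⟨w, hwx, hwz⟩ := exists_isAlmostConvexSubseq_of_chain
        ((Cardinal.mk_set_le (Set.Iio i)).trans_lt hI) (fun j => (hz j).1) hanti
      obtain ⟨y, hyw, hy⟩ := hdense i w hwx
      exact ⟨y, ⟨hyw.trans hwx, hy⟩, fun j => hyw.trans (hwz j)⟩
  obtain ⟨w, hwx, hwz⟩ := exists_isAlmostConvexSubseq_of_chain hI (fun i => (hz i).1) hanti
  exact ⟨w, hwx, fun i => hmono i w (z i) (hwz i) (hz i).2⟩

end Diagonal

section WeaklyCompact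

variable {E F : Type*} [NormedAddCommGroup E] [NormedSpace ℝ E] [NormedAddCommGroup F]
  [NormedSpace ℝ F]

theorem continuous_apply_toWeakSpace_symm (f : StrongDual ℝ E) :
    Continuous fun x : WeakSpace ℝ E => f ((toWeakSpace ℝ E).symm x) :=
  WeakBilin.eval_continuous (topDualPairing ℝ E).flip f

theorem isBounded_of_isCompact_toWeakSpace_image {K : Set E}
    (hK : IsCompact (toWeakSpace ℝ E '' K)) : Bornology.IsBounded K := by
  obtain ⟨R, hR⟩ := banach_steinhaus
    (g := fun v : K => NormedSpace.inclusionInDoubleDual ℝ E v) fun f => by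
      obtain ⟨C, hC⟩ := (hK.image (continuous_apply_toWeakSpace_symm f)).isBounded.exists_norm_le
      exact ⟨C, fun v => hC (f v) ⟨toWeakSpace ℝ E v, ⟨v, v.2, rfl⟩, by simp⟩⟩
  refine isBounded_iff_forall_norm_le.2 ⟨R, fun v hv => ?_⟩
  exact ((NormedSpace.inclusionInDoubleDualLi ℝ (E := E)).norm_map v).symm.trans_le (hR ⟨v, hv⟩)

theorem isCompact_toWeakSpace_image_image {K : Set E} (hK : IsCompact (toWeakSpace ℝ E '' K))
    (T : E →L[ℝ] F) : IsCompact (toWeakSpace ℝ F '' (T '' K)) := by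
  have himage := hK.image (WeakSpace.map T).continuous
  rwa [Set.image_image] at himage ⊢

end WeaklyCompact

section Mackey

variable {X Y V : Type*} [NormedAddCommGroup X] [NormedSpace ℝ X] [NormedAddCommGroup Y]
  [NormedSpace ℝ Y] [SeminormedAddCommGroup V] [NormedSpace ℝ V]

instance : LocallyConvexSpace ℝ (MackeyDual X) := by
  refine UniformConvergenceCLM.locallyConvexSpace ℝ _ ⟨∅, ?_⟩
    (directedOn_of_sup_mem fun K L hK hL => ?_)
  · simp [weaklyCompactSets]
  · simpa only [weaklyCompactSets, Set.mem_ofPred_eq, Set.sup_eq_union, Set.image_union]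
      using hK.union hL

/-- The identity of the dual of `X`, as a continuous linear map from the norm topology to the
Mackey topology. -/
noncomputable def toMackeyDualCLM : StrongDual ℝ X →L[ℝ] MackeyDual X where
  toLinearMap :=
    (ContinuousLinearMap.toUniformConvergenceCLM (RingHom.id ℝ) ℝ (weaklyCompactSets X)).toLinearMap
  cont := continuous_id_of_le <| UniformConvergenceCLM.topologicalSpace_mono (RingHom.id ℝ) ℝ
    fun _ hL => NormedSpace.isVonNBounded_of_isBounded ℝ
      (isBounded_of_isCompact_toWeakSpace_image hL)

theorem IsAlmostConvexSubseq.tendsto_toMackeyDual (T : V →L[ℝ] StrongDual ℝ X) {y z : ℕ → V}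
    {f : StrongDual ℝ X} (h : IsAlmostConvexSubseq y z)
    (hz : Tendsto (fun n => toMackeyDual (T (z n))) atTop (𝓝 (toMackeyDual f))) :
    Tendsto (fun n => toMackeyDual (T (y n))) atTop (𝓝 (toMackeyDual f)) :=
  h.tendsto (toMackeyDualCLM.comp T) hz

theorem IsAlmostConvexSubseq.tendsto_apply {y z : ℕ → StrongDual ℝ X} {v : X} {c : ℝ}
    (h : IsAlmostConvexSubseq y z) (hz : Tendsto (fun n => z n v) atTop (𝓝 c)) :
    Tendsto (fun n => y n v) atTop (𝓝 c) :=
  h.tendsto (ContinuousLinearMap.apply ℝ ℝ v) hz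

theorem tendsto_apply_of_tendsto_toMackeyDual {y : ℕ → StrongDual ℝ X} {f : StrongDual ℝ X}
    (h : Tendsto (fun n => toMackeyDual (y n)) atTop (𝓝 (toMackeyDual f))) (v : X) :
    Tendsto (fun n => y n v) atTop (𝓝 (f v)) :=
  tendstoUniformlyOn_singleton_iff_tendsto.1 ((tendsto_toMackeyDual_iff y f).1 h {v} (by simp))

theorem tendsto_toMackeyDual_comp (T : X →L[ℝ] Y) {y : ℕ → StrongDual ℝ Y} {f : StrongDual ℝ Y}
    (h : Tendsto (fun n => toMackeyDual (y n)) atTop (𝓝 (toMackeyDual f))) :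
    Tendsto (fun n => toMackeyDual ((y n).comp T)) atTop (𝓝 (toMackeyDual (f.comp T))) :=
  ((T.precompUniformConvergenceCLM ℝ (weaklyCompactSets X) (weaklyCompactSets Y)
    fun _ hL => isCompact_toWeakSpace_image_image hL T).continuous.tendsto _).comp h

theorem PropertyK.exists_tendsto (hK : PropertyK X) {x : ℕ → StrongDual ℝ X}
    {f : StrongDual ℝ X} (hx : ∀ v, Tendsto (fun n => x n v) atTop (𝓝 (f v))) :
    ∃ y, IsConvexBlockSubseq y x ∧
      Tendsto (fun n => toMackeyDual (y n)) atTop (𝓝 (toMackeyDual f)) := by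
  obtain ⟨y, hyx, g, hyg⟩ := hK x f (tendsto_iff_forall_eval_tendsto_topDualPairing.2 hx)
  have hgf : g = f := ContinuousLinearMap.ext fun v =>
    tendsto_nhds_unique (tendsto_apply_of_tendsto_toMackeyDual hyg v)
      ((IsAlmostConvexSubseq.of_isConvexBlockSubseq hyx).tendsto_apply (hx v))
  exact ⟨y, hyx, hgf ▸ hyg⟩

theorem PropertyK.exists_isAlmostConvexSubseq_tendsto (hK : PropertyK X)
    (T : V →L[ℝ] StrongDual ℝ X) {z : ℕ → V} {f : StrongDual ℝ X}
    (hz : ∀ v, Tendsto (fun n => T (z n) v) atTop (𝓝 (f v))) :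
    ∃ y, IsAlmostConvexSubseq y z ∧
      Tendsto (fun n => toMackeyDual (T (y n))) atTop (𝓝 (toMackeyDual f)) := by
  obtain ⟨y, hy, htendsto⟩ := hK.exists_tendsto (x := T ∘ z) hz
  obtain ⟨w, hw, rfl⟩ := hy.exists_eq_comp T.toLinearMap
  exact ⟨w, .of_isConvexBlockSubseq hw, htendsto⟩

end Mackey

section Schur

variable {ι : Type*}

theorem hasSum_norm_lp_one {X : ι → Type*} [∀ i, NormedAddCommGroup (X i)] (f : lp X 1) :
    HasSum (fun i => ‖f i‖) ‖f‖ := by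
  simpa using lp.hasSum_norm (p := 1) (by simp) f

/-- The functional `w ↦ ∑ i, s i * w i` on `ℓ¹(ι)` given by a point `s` of the cube `[-1, 1]^ι`,
which is compact in the product topology. -/
noncomputable def cubeFunctional (s : ι → Set.Icc (-1 : ℝ) 1) :
    StrongDual ℝ (lp (fun _ : ι => ℝ) 1) :=
  lp.tsumCLM ℝ ι ℝ ∘L lp.mapCLM 1 (fun i => (s i : ℝ) • ContinuousLinearMap.id ℝ ℝ) zero_le_one
    fun i => by simpa [norm_smul] using abs_le.2 (s i).2

theorem cubeFunctional_apply (s : ι → Set.Icc (-1 : ℝ) 1) (w : lp (fun _ : ι => ℝ) 1) :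
    cubeFunctional s w = ∑' i, (s i : ℝ) * w i := by
  simp [cubeFunctional, lp.tsumCLM_apply]

theorem norm_coe_mul_le_norm (t : Set.Icc (-1 : ℝ) 1) (r : ℝ) : ‖(t : ℝ) * r‖ ≤ ‖r‖ := by
  rw [norm_mul]
  exact mul_le_of_le_one_left (norm_nonneg r) (abs_le.2 t.2)

theorem continuous_cubeFunctional_apply (w : lp (fun _ : ι => ℝ) 1) :
    Continuous fun s => cubeFunctional s w := by
  simp only [cubeFunctional_apply]
  exact continuous_tsum (fun i => by fun_prop) (hasSum_norm_lp_one w).summable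
    fun i s => norm_coe_mul_le_norm (s i) (w i)

theorem norm_le_cubeFunctional_add_sum {s : ι → Set.Icc (-1 : ℝ) 1} {w : lp (fun _ : ι => ℝ) 1}
    {M : Finset ι} (hs : ∀ i ∉ M, (s i : ℝ) * w i = ‖w i‖) :
    ‖w‖ ≤ cubeFunctional s w + 2 * ∑ i ∈ M, ‖w i‖ := by
  have hle : ∀ i, ‖(s i : ℝ) * w i‖ ≤ ‖w i‖ := fun i => norm_coe_mul_le_norm _ _
  have hsum : HasSum (fun i => (s i : ℝ) * w i) (cubeFunctional s w) :=
    cubeFunctional_apply s w ▸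
      ((hasSum_norm_lp_one w).summable.of_norm_bounded hle).hasSum
  have hdiff : HasSum (fun i => ‖w i‖ - (s i : ℝ) * w i) (∑ i ∈ M, (‖w i‖ - (s i : ℝ) * w i)) :=
    hasSum_sum_of_ne_finset_zero fun i hi => by rw [hs i hi, sub_self]
  have heq := ((hasSum_norm_lp_one w).sub hsum).unique hdiff
  have hbound : ∑ i ∈ M, (‖w i‖ - (s i : ℝ) * w i) ≤ ∑ i ∈ M, 2 * ‖w i‖ :=
    Finset.sum_le_sum fun i _ => by linarith [neg_le_of_abs_le (hle i)]
  rw [← Finset.mul_sum] at hbound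
  linarith

theorem exists_mem_Icc_mul_eq_norm (r : ℝ) : ∃ t : Set.Icc (-1 : ℝ) 1, (t : ℝ) * r = ‖r‖ := by
  rcases le_total 0 r with hr | hr
  · exact ⟨⟨1, by norm_num⟩, by simp [abs_of_nonneg hr]⟩
  · exact ⟨⟨-1, by norm_num⟩, by simp [abs_of_nonpos hr]⟩

theorem exists_forall_eqOn_abs_cubeFunctional_le {w : ℕ → lp (fun _ : ι => ℝ) 1}
    (hw : ∀ φ : StrongDual ℝ (lp (fun _ : ι => ℝ) 1), Tendsto (fun n => φ (w n)) atTop (𝓝 0))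
    {ε : ℝ} (hε : 0 < ε) :
    ∃ (s : ι → Set.Icc (-1 : ℝ) 1) (M : Finset ι) (N : ℕ), ∀ t, Set.EqOn t s M →
      ∀ n ≥ N, |cubeFunctional t (w n)| ≤ ε := by
  let B : ℕ → Set (ι → Set.Icc (-1 : ℝ) 1) := fun N =>
    {s | ∀ n ≥ N, |cubeFunctional s (w n)| ≤ ε}
  have hclosed : ∀ N, IsClosed (B N) := fun N => by
    simp only [B, Set.ofPred_forall]
    exact isClosed_iInter fun n => isClosed_iInter fun _ =>
      isClosed_le (continuous_cubeFunctional_apply (w n)).abs continuous_const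
  have hcover : ⋃ N, B N = Set.univ := Set.eq_univ_of_forall fun s =>
    Set.mem_iUnion.2 <| eventually_atTop.1 <| by
      simpa using (hw (cubeFunctional s)).abs.eventually_le_const (by simpa using hε)
  have : Nonempty (Set.Icc (-1 : ℝ) 1) := ⟨0, by norm_num⟩
  obtain ⟨N, s, hs⟩ := nonempty_interior_of_iUnion_of_closed hclosed hcover
  obtain ⟨M, U, hU, hUN⟩ := isOpen_pi_iff.1 isOpen_interior s hs
  exact ⟨s, M, N, fun t ht => interior_subset (hUN fun i hi => ht hi ▸ (hU i hi).2)⟩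

/-- The neighbourhood provided by Baire's theorem constrains only finitely many coordinates, so the
others may be chosen as the signs of those of `w n`. -/
theorem tendsto_zero_lp_one_of_forall_tendsto_apply_zero {w : ℕ → lp (fun _ : ι => ℝ) 1}
    (hw : ∀ φ : StrongDual ℝ (lp (fun _ : ι => ℝ) 1), Tendsto (fun n => φ (w n)) atTop (𝓝 0)) :
    Tendsto w atTop (𝓝 0) := by
  classical
  rw [tendsto_zero_iff_norm_tendsto_zero]
  refine tendsto_order.2 ⟨fun a ha => .of_forall fun n => ha.trans_le (norm_nonneg _),
    fun ε hε => ?_⟩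
  obtain ⟨s, M, N, hN⟩ := exists_forall_eqOn_abs_cubeFunctional_le hw (half_pos hε)
  choose σ hσ using exists_mem_Icc_mul_eq_norm
  have hbound : ∀ n ≥ N, ‖w n‖ ≤ ε / 2 + 2 * ∑ i ∈ M, ‖w n i‖ := fun n hn => by
    refine (norm_le_cubeFunctional_add_sum (M := M)
      (s := fun i => if i ∈ M then s i else σ (w n i)) fun i hi => ?_).trans ?_
    · simp only [if_neg hi, hσ]
    · gcongr
      exact (le_abs_self _).trans (hN _ (fun i hi => if_pos hi) n hn)
  have hcoord : Tendsto (fun n => ε / 2 + 2 * ∑ i ∈ M, ‖w n i‖) atTop (𝓝 (ε / 2)) := by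
    have hM := tendsto_finsetSum M fun i _ => (hw (lp.evalCLM ℝ _ 1 i)).norm
    simpa [lp.evalCLM] using (hM.const_mul 2).const_add (ε / 2)
  filter_upwards [hcoord.eventually_lt_const (half_lt_self hε), eventually_ge_atTop N] with n h hn
  exact (hbound n hn).trans_lt h

theorem isSeqCompact_lp_one_of_isCompact_toWeakSpace_image [Countable ι]
    {K : Set (lp (fun _ : ι => ℝ) 1)} (hK : IsCompact (toWeakSpace ℝ _ '' K)) :
    IsSeqCompact K := by
  -- The coordinates embed the weakly compact set into the first countable space `ι → ℝ`.
  let coord : WeakSpace ℝ (lp (fun _ : ι => ℝ) 1) → ι → ℝ := fun x i =>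
    (toWeakSpace ℝ _).symm x i
  have hcoord : Continuous coord := continuous_pi fun i =>
    continuous_apply_toWeakSpace_symm (lp.evalCLM ℝ (fun _ : ι => ℝ) 1 i)
  have hinj : Function.Injective coord := fun x y h =>
    (toWeakSpace ℝ _).symm.injective (lp.ext h)
  have := isCompact_iff_compactSpace.1 hK
  have : FirstCountableTopology (toWeakSpace ℝ _ '' K) :=
    ((hcoord.comp continuous_subtype_val).isClosedEmbedding
      (hinj.comp Subtype.val_injective)).isInducing.firstCountableTopology
  intro x hx
  obtain ⟨⟨_, a, ha, rfl⟩, φ, hφ, hlim⟩ := SeqCompactSpace.tendsto_subseq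
    fun n => (⟨toWeakSpace ℝ _ (x n), x n, hx n, rfl⟩ : toWeakSpace ℝ _ '' K)
  refine ⟨a, ha, φ, hφ, tendsto_sub_nhds_zero_iff.1 ?_⟩
  refine tendsto_zero_lp_one_of_forall_tendsto_apply_zero fun f => ?_
  have hf := ((continuous_apply_toWeakSpace_symm f).comp continuous_subtype_val).tendsto _ |>.comp
    hlim
  simpa [Function.comp_def] using hf.sub_const (f a)

end Schur

section Tails

theorem exists_forall_norm_apply_le_of_isCompact_toWeakSpace_image
    {K : Set (lp (fun _ : ℕ => ℝ) 1)} (hK : IsCompact (toWeakSpace ℝ _ '' K)) {ε : ℝ}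
    (hε : 0 < ε) : ∃ n, ∀ v ∈ K, ‖v n‖ ≤ ε := by
  by_contra! hcon
  choose v hvK hv using hcon
  obtain ⟨a, -, φ, hφ, hlim⟩ := isSeqCompact_lp_one_of_isCompact_toWeakSpace_image hK hvK
  have hdist : Tendsto (fun n => ‖v (φ n) - a‖ + ‖a (φ n)‖) atTop (𝓝 0) := by
    simpa using (tendsto_iff_norm_sub_tendsto_zero.1 hlim).add
      ((hasSum_norm_lp_one a).summable.tendsto_atTop_zero.comp hφ.tendsto_atTop)
  obtain ⟨n, hn⟩ := (hdist.eventually_lt_const hε).exists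
  refine (hv (φ n)).not_ge (le_trans ?_ hn.le)
  calc ‖v (φ n) (φ n)‖ = ‖(v (φ n) - a) (φ n) + a (φ n)‖ := by simp
    _ ≤ ‖(v (φ n) - a) (φ n)‖ + ‖a (φ n)‖ := norm_add_le _ _
    _ ≤ ‖v (φ n) - a‖ + ‖a (φ n)‖ := by gcongr; exact lp.norm_apply_le_norm one_ne_zero _ _

theorem exists_clm_lp_one_apply_eq {ι E : Type*} [NormedAddCommGroup E] [NormedSpace ℝ E]
    {g : ι → StrongDual ℝ E} {C : ℝ} (hg : ∀ v, ∀ A : Finset ι, ∑ n ∈ A, ‖g n v‖ ≤ C * ‖v‖) :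
    ∃ T : E →L[ℝ] lp (fun _ : ι => ℝ) 1, ∀ v n, T v n = g n v := by
  have hmem : ∀ v, Memℓp (fun n => g n v) 1 := fun v => memℓp_gen' fun A => by simpa using hg v A
  let T : E →ₗ[ℝ] lp (fun _ : ι => ℝ) 1 :=
    { toFun := fun v => ⟨fun n => g n v, hmem v⟩
      map_add' := fun v w => lp.ext (funext fun n => map_add (g n) v w)
      map_smul' := fun c v => lp.ext (funext fun n => map_smul (g n) c v) }
  refine ⟨T.mkContinuous C fun v => ?_, fun v n => rfl⟩
  exact lp.norm_le_of_forall_sum_le (by simp) (by simpa using hg v ∅) fun A => by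
    simpa [T] using hg v A

variable {I : Type*} {X : I → Type*} [∀ i, NormedAddCommGroup (X i)]
  [∀ i, NormedSpace ℝ (X i)]

theorem exists_clm_lp_one_apply_eq_sum_norm {F : ℕ → Finset I}
    (hF : Pairwise (Function.onFun Disjoint F)) (v : ℕ → lp X 1) :
    ∃ T : lp X 1 →L[ℝ] lp (fun _ : ℕ => ℝ) 1, ∀ n, T (v n) n = ∑ i ∈ F n, ‖v n i‖ := by
  classical
  choose ψ hψ_norm hψ using fun n i => exists_dual_vector'' ℝ (v n i)
  let g : ℕ → StrongDual ℝ (lp X 1) := fun n => ∑ i ∈ F n, (ψ n i).comp (lp.evalCLM ℝ X 1 i)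
  have hg_apply : ∀ n w, g n w = ∑ i ∈ F n, ψ n i (w i) := fun n w => by
    simp [g, lp.evalCLM]
  have hg_norm : ∀ n w, ‖g n w‖ ≤ ∑ i ∈ F n, ‖w i‖ := fun n w => by
    rw [hg_apply]
    exact norm_sum_le_of_le _ fun i _ => by
      simpa using (ψ n i).le_of_opNorm_le (hψ_norm n i) (w i)
  have hg : ∀ w, ∀ A : Finset ℕ, ∑ n ∈ A, ‖g n w‖ ≤ 1 * ‖w‖ := fun w A => by
    calc ∑ n ∈ A, ‖g n w‖ ≤ ∑ n ∈ A, ∑ i ∈ F n, ‖w i‖ := Finset.sum_le_sum fun n _ => hg_norm n w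
      _ = ∑ i ∈ A.biUnion F, ‖w i‖ := (Finset.sum_biUnion fun m _ n _ hmn => hF hmn).symm
      _ ≤ ‖w‖ := sum_le_hasSum _ (fun _ _ => norm_nonneg _) (hasSum_norm_lp_one w)
      _ = 1 * ‖w‖ := (one_mul _).symm
  obtain ⟨T, hT⟩ := exists_clm_lp_one_apply_eq hg
  refine ⟨T, fun n => ?_⟩
  rw [hT, hg_apply]
  exact Finset.sum_congr rfl fun i _ => hψ n i

/-- The canonical projection of the `ℓ¹`-sum onto the coordinates in `J`. -/
noncomputable def coordProj [DecidableEq I] (X : I → Type*) [∀ i, NormedAddCommGroup (X i)]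
    [∀ i, NormedSpace ℝ (X i)] (J : Finset I) : lp X 1 →L[ℝ] lp X 1 :=
  ∑ i ∈ J, lp.singleContinuousLinearMap ℝ X 1 i ∘L lp.evalCLM ℝ X 1 i

theorem exists_disjoint_lt_sum_norm [DecidableEq I] {v : lp X 1} {J : Finset I} {ε : ℝ}
    (h : ε < ‖v - coordProj X J v‖) : ∃ F : Finset I, Disjoint J F ∧ ε < ∑ i ∈ F, ‖v i‖ := by
  have hnorm : ‖v - coordProj X J v‖ = ‖v‖ - ∑ i ∈ J, ‖v i‖ := by
    have hcompl := lp.norm_compl_sum_single (p := 1) (by simp) v J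
    simp only [ENNReal.toReal_one, Real.rpow_one] at hcompl
    rw [← hcompl]
    simp [coordProj, lp.evalCLM]
  obtain ⟨F, hF, hJF⟩ := (((hasSum_norm_lp_one v).eventually_const_lt
    (lt_sub_iff_add_lt.1 (h.trans_eq hnorm))).and (eventually_ge_atTop J)).exists
  refine ⟨F \ J, Finset.disjoint_sdiff, ?_⟩
  linarith [Finset.sum_sdiff (f := fun i => ‖v i‖) hJF]

theorem exists_forall_norm_sub_coordProj_le [DecidableEq I] {K : Set (lp X 1)}
    (hK : IsCompact (toWeakSpace ℝ (lp X 1) '' K)) {ε : ℝ} (hε : 0 < ε) :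
    ∃ J : Finset I, ∀ v ∈ K, ‖v - coordProj X J v‖ ≤ ε := by
  by_contra! hcon
  obtain ⟨a, ha, hdisj⟩ := exists_seq_of_forall_finset_exists
    (fun a : lp X 1 × Finset I => a.1 ∈ K ∧ ε < ∑ i ∈ a.2, ‖a.1 i‖)
    (fun a b => Disjoint a.2 b.2) fun s _ => by
      obtain ⟨v, hvK, hv⟩ := hcon (s.biUnion Prod.snd)
      obtain ⟨F, hF, hvF⟩ := exists_disjoint_lt_sum_norm hv
      exact ⟨(v, F), ⟨hvK, hvF⟩, fun b hb => hF.mono_left (Finset.subset_biUnion_of_mem _ hb)⟩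
  obtain ⟨T, hT⟩ := exists_clm_lp_one_apply_eq_sum_norm
    ((pairwise_disjoint_on fun n => (a n).2).2 hdisj) fun n => (a n).1
  obtain ⟨n, hn⟩ := exists_forall_norm_apply_le_of_isCompact_toWeakSpace_image
    (isCompact_toWeakSpace_image_image hK T) hε
  have hle := hn _ ⟨_, (ha n).1, rfl⟩
  rw [hT n] at hle
  exact (ha n).2.not_ge ((le_abs_self _).trans hle)

end Tails

section Coordinatewise

theorem exists_forall_norm_sub_le_of_tendsto_apply {E : Type*} [NormedAddCommGroup E]
    [NormedSpace ℝ E] [CompleteSpace E] {y : ℕ → StrongDual ℝ E} {f : StrongDual ℝ E}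
    (h : ∀ v, Tendsto (fun n => y n v) atTop (𝓝 (f v))) : ∃ C, ∀ n, ‖y n - f‖ ≤ C :=
  banach_steinhaus fun v => by
    obtain ⟨c, hc⟩ := ((h v).sub_const (f v)).norm.bddAbove_range
    exact ⟨c, fun n => hc ⟨n, rfl⟩⟩

variable {I : Type*} [DecidableEq I] {X : I → Type*} [∀ i, NormedAddCommGroup (X i)]
  [∀ i, NormedSpace ℝ (X i)]

theorem tendsto_toMackeyDual_comp_coordProj {y : ℕ → StrongDual ℝ (lp X 1)}
    {f : StrongDual ℝ (lp X 1)} {J : Finset I}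
    (h : ∀ i ∈ J, Tendsto
      (fun n => toMackeyDual ((y n).comp (lp.singleContinuousLinearMap ℝ X 1 i))) atTop
      (𝓝 (toMackeyDual (f.comp (lp.singleContinuousLinearMap ℝ X 1 i))))) :
    Tendsto (fun n => toMackeyDual ((y n).comp (coordProj X J))) atTop
      (𝓝 (toMackeyDual (f.comp (coordProj X J)))) := by
  have hsum : ∀ g : StrongDual ℝ (lp X 1), toMackeyDual (g.comp (coordProj X J)) =
      ∑ i ∈ J, toMackeyDual
        ((g.comp (lp.singleContinuousLinearMap ℝ X 1 i)).comp (lp.evalCLM ℝ X 1 i)) := fun g => by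
    rw [coordProj, ContinuousLinearMap.comp_finsetSum]
    exact map_sum toMackeyDualCLM _ J
  simp only [hsum]
  exact tendsto_finsetSum J fun i hi => tendsto_toMackeyDual_comp (lp.evalCLM ℝ X 1 i) (h i hi)

theorem tendsto_toMackeyDual_of_forall_comp_single [∀ i, CompleteSpace (X i)]
    {y : ℕ → StrongDual ℝ (lp X 1)} {f : StrongDual ℝ (lp X 1)}
    (hy : ∀ v, Tendsto (fun n => y n v) atTop (𝓝 (f v)))
    (h : ∀ i, Tendsto
      (fun n => toMackeyDual ((y n).comp (lp.singleContinuousLinearMap ℝ X 1 i))) atTop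
      (𝓝 (toMackeyDual (f.comp (lp.singleContinuousLinearMap ℝ X 1 i))))) :
    Tendsto (fun n => toMackeyDual (y n)) atTop (𝓝 (toMackeyDual f)) := by
  obtain ⟨C, hC⟩ := exists_forall_norm_sub_le_of_tendsto_apply hy
  have hC_nonneg : 0 ≤ C := (norm_nonneg _).trans (hC 0)
  refine (tendsto_toMackeyDual_iff y f).2 fun L hL => Metric.tendstoUniformlyOn_iff.2 fun ε hε => ?_
  obtain ⟨J, hJ⟩ := exists_forall_norm_sub_coordProj_le hL
    (by positivity : 0 < ε / 2 / (C + 1))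
  have hproj := (tendsto_toMackeyDual_iff _ _).1
    (tendsto_toMackeyDual_comp_coordProj (J := J) fun i _ => h i) L hL
  filter_upwards [Metric.tendstoUniformlyOn_iff.1 hproj (ε / 2) (half_pos hε)] with n hn v hv
  have htail : ‖(y n - f) (v - coordProj X J v)‖ ≤ ε / 2 := by
    calc ‖(y n - f) (v - coordProj X J v)‖ ≤ (C + 1) * (ε / 2 / (C + 1)) :=
          (y n - f).le_of_opNorm_le_of_le ((hC n).trans (by linarith)) (hJ v hv)
      _ = ε / 2 := by field_simp
  have hhead : ‖(y n - f) (coordProj X J v)‖ < ε / 2 := by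
    simpa [Real.dist_eq, abs_sub_comm] using hn v hv
  calc dist (f v) (y n v) = ‖(y n - f) (v - coordProj X J v) + (y n - f) (coordProj X J v)‖ := by
        rw [← map_add, sub_add_cancel, dist_comm, dist_eq_norm]; rfl
    _ ≤ ‖(y n - f) (v - coordProj X J v)‖ + ‖(y n - f) (coordProj X J v)‖ := norm_add_le _ _
    _ < ε := by linarith

end Coordinatewise

/-- The `ℓ¹`-sum of fewer than `𝔭` real Banach spaces with property (K) has property (K). -/
theorem theorem2p10 {I : Type u} (X : I → Type v)
    [∀ i, NormedAddCommGroup (X i)] [∀ i, NormedSpace ℝ (X i)] [∀ i, CompleteSpace (X i)]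
    (hK : ∀ i, PropertyK (X i))
    (hI : #I < Cardinal.lift.{u} pseudoIntersectionNumber) :
    PropertyK (lp X 1) := by
  classical
  intro x x₀ hx
  replace hx : ∀ v, Tendsto (fun n => x n v) atTop (𝓝 (x₀ v)) := fun v =>
    ((WeakDual.eval_continuous v).tendsto _).comp hx
  let T : ∀ i, StrongDual ℝ (lp X 1) →L[ℝ] StrongDual ℝ (X i) := fun i =>
    ContinuousLinearMap.precomp ℝ (lp.singleContinuousLinearMap ℝ X 1 i)
  obtain ⟨z, hzx, hz⟩ := exists_isAlmostConvexSubseq_forall hI (x := x)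
    (D := fun i y => Tendsto (fun n => toMackeyDual (T i (y n))) atTop
      (𝓝 (toMackeyDual (T i x₀))))
    (fun i _ _ hyz hz => hyz.tendsto_toMackeyDual (T i) hz)
    fun i z hzx => (hK i).exists_isAlmostConvexSubseq_tendsto (T i) fun v =>
      hzx.tendsto_apply (hx (lp.singleContinuousLinearMap ℝ X 1 i v))
  obtain ⟨y, hyx, hyz⟩ := hzx.exists_isConvexBlockSubseq
  refine ⟨y, hyx, x₀, tendsto_toMackeyDual_of_forall_comp_single (fun v => ?_) fun i => ?_⟩
  · exact (IsAlmostConvexSubseq.of_isConvexBlockSubseq hyx).tendsto_apply (hx v)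
  · exact hyz.tendsto_toMackeyDual (T i) (hz i)
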